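/- For $N\in\mathbb{Z}_{\ge 0}$ put $(a;q)_N=\prod_{0\le j<N}(1-aq^j)$, and for a Laurent polynomial $f$ in $z$ with coefficients in $\mathbb{Z}[q]$ let $\mathrm{CT}_z[f]\in\mathbb{Z}[q]$ denote the coefficient of $z^0$ in $f$. A polynomial $\sum_{0\le i\le d}c_iq^i$ of degree $d$ (with $d=0$ for constants) is called unimodal if there is an index $0\le p\le d$ with $c_0\le c_1\le\cdots\le c_p\ge c_{p+1}\ge\cdots\ge c_d$. **Theorem.** For all integers $m,n\ge 0$ and $k\ge 1$, Andrews' generalized Gauss polynomial of type $ck$, $$\mathrm{CT}_z\left[(-qz;q)_m^k\,(-z^{-1};q)_n^k\right]\in\mathbb{Z}[q],$$ is unimodal. -/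

import Mathlib

/-- The `q`-shifted factorial `(a; q)_n = ∏_{0 ≤ j < n} (1 - a q ^ j)`. -/
def qShiftedFactorial {R : Type*} [CommRing R] (a q : R) (n : ℕ) : R :=
  ∏ j ∈ Finset.range n, (1 - a * q ^ j)

/-- The constant term `CT_z f(z)` of a Laurent polynomial in `z` over `R`. -/
def constantTermZ {R : Type*} [Semiring R] (f : LaurentPolynomial R) : R :=
  f.coeff 0

/-- Andrews' generalized Gauss polynomial of type `ck`: the constant term in `z` of
`(-q z; q)_m ^ k * (-z⁻¹; q)_n ^ k`. The computation takes place in Laurent polynomials in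
`z = T 1` over `ℤ[q]`, the variable `q` being `Polynomial.X`. -/
noncomputable def andrewsGaussC (k m n : ℕ) : Polynomial ℤ :=
  constantTermZ
    (qShiftedFactorial
        (-((LaurentPolynomial.C (Polynomial.X : Polynomial ℤ)) * LaurentPolynomial.T 1))
        (LaurentPolynomial.C (Polynomial.X : Polynomial ℤ)) m ^ k *
      qShiftedFactorial
        (-(LaurentPolynomial.T (-1) : LaurentPolynomial (Polynomial ℤ)))
        (LaurentPolynomial.C (Polynomial.X : Polynomial ℤ)) n ^ k)

/-- The finite sequence `c 0, …, c N` is unimodal: it first (weakly) increases and then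
(weakly) decreases. -/
def IsUnimodalUpTo {α : Type*} [Preorder α] (N : ℕ) (c : ℕ → α) : Prop :=
  ∃ p ≤ N, MonotoneOn c (Set.Icc 0 p) ∧ AntitoneOn c (Set.Icc p N)

/-- A polynomial is unimodal if its sequence of coefficients `c_0, …, c_N`, where `N` is its
degree, is unimodal. -/
def IsUnimodalPolynomial {R : Type*} [Semiring R] [Preorder R] (f : Polynomial R) : Prop :=
  IsUnimodalUpTo f.natDegree f.coeff

/-!
The product `(-q z; q)_m (-z⁻¹; q)_n` is, up to a monomial, `∏ (1 + z q ^ p)` over `n + m`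
consecutive exponents `p`. Hence, with `V` the irreducible representation of `𝔰𝔩₂` of dimension
`n + m`, the constant term of its `k`-th power is, up to a power of `q`, the character of the
exterior power of degree `k n` of `V ⊕ ⋯ ⊕ V` (`k` copies). Its weights all have the same parity,
and raising a weight by two raises the exponent of `q` by one, so the coefficients are unimodal with
centre `k m n / 2`.

This is made elementary as follows. A basis of the exterior algebra is given by the configurations of
particles on `k` chains of `n + m` sites, and the coefficient of `q ^ s` is the number of neutral
configurations of energy `s` (`coeff_andrewsGaussC`). The raising operator `E` lets one particle hop
to the next site, with coefficients chosen such that the lowering operator `F` is its transpose and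
`[E, F] = H` is diagonal (`hopSum_commutator`), with eigenvalue `2 s - k m n` on the neutral
configurations of energy `s` (`hopWeight_neutralConfigs`). If `E f = 0`, then
`‖F f‖² = ⟨f, H f⟩`, so `E` is injective wherever `H < 0` (`eq_zero_of_hopSum_eq_zero`). Comparing
dimensions, the coefficients increase below the centre, and by the same argument with `E` and `F`
exchanged they decrease above it.
-/

/-! ### Hopping operators -/

variable {ι : Type*} [DecidableEq ι]

/-- The hopping operator on functions of configurations `ι → Bool` (`true` marks an occupied site).
It is the linear extension of moving a particle from `s` to the empty site `t`: the value at `x`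
is the value of `f` at the configuration before the move, and `0` if `x` does not arise in this
way. -/
def hop (s t : ι) : Module.End ℝ ((ι → Bool) → ℝ) where
  toFun f x := if x t = true ∧ x s = false then f (x ∘ Equiv.swap s t) else 0
  map_add' f g := by
    ext x
    by_cases h : x t = true ∧ x s = false <;> simp [h]
  map_smul' c f := by
    ext x
    by_cases h : x t = true ∧ x s = false <;> simp [h]

theorem hop_apply (s t : ι) (f : (ι → Bool) → ℝ) (x : ι → Bool) :
    hop s t f x = if x t = true ∧ x s = false then f (x ∘ Equiv.swap s t) else 0 := rfl

theorem comp_swap_comp_swap (s t : ι) (x : ι → Bool) :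
    (x ∘ Equiv.swap s t) ∘ Equiv.swap s t = x := by
  ext i; simp

/-- Hopping from `t` to `s` is the transpose of hopping from `s` to `t`. -/
theorem sum_mul_hop [Fintype ι] (s t : ι) (f g : (ι → Bool) → ℝ) :
    ∑ x, g x * hop s t f x = ∑ x, hop t s g x * f x := by
  refine Finset.sum_nbij' (fun x => x ∘ Equiv.swap s t) (fun x => x ∘ Equiv.swap s t)
    (by simp) (by simp) (fun x _ => comp_swap_comp_swap s t x)
    (fun x _ => comp_swap_comp_swap s t x) (fun x _ => ?_)
  simp only [hop_apply, Function.comp_apply, Equiv.swap_apply_left, Equiv.swap_apply_right,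
    Equiv.swap_comm t s, comp_swap_comp_swap]
  split_ifs <;> simp

theorem hop_hop_reverse_apply (s t : ι) (f : (ι → Bool) → ℝ) (x : ι → Bool) :
    hop s t (hop t s f) x = if x t = true ∧ x s = false then f x else 0 := by
  simp only [hop_apply, Function.comp_apply, Equiv.swap_apply_left, Equiv.swap_apply_right,
    Equiv.swap_comm t s, comp_swap_comp_swap]
  split_ifs <;> simp_all

/-- A hop along one edge commutes with the reverse hop along another edge. If the edges are disjoint
this is clear; if they are consecutive, both composites vanish by exclusion, since both hops would
leave, or both would enter, the common site. -/
theorem hop_commute {s t s' t' : ι} (hs : s ≠ s') (ht : t ≠ t') :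
    Commute (hop s t) (hop t' s') := by
  refine LinearMap.ext fun f => funext fun x => ?_
  change hop s t (hop t' s' f) x = hop t' s' (hop s t f) x
  simp only [hop_apply, Function.comp_apply]
  by_cases h1 : t = s'
  · subst h1
    simp only [Equiv.swap_apply_right]
    grind
  by_cases h2 : s = t'
  · subst h2
    simp only [Equiv.swap_apply_left]
    grind
  simp only [Equiv.swap_apply_of_ne_of_ne hs.symm (Ne.symm h1),
    Equiv.swap_apply_of_ne_of_ne (Ne.symm h2) ht.symm,
    Equiv.swap_apply_of_ne_of_ne h2 hs, Equiv.swap_apply_of_ne_of_ne ht h1]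
  -- The two edges are now disjoint, so the swaps commute.
  have h7 : (x ∘ Equiv.swap s t) ∘ Equiv.swap t' s' = (x ∘ Equiv.swap t' s') ∘ Equiv.swap s t := by
    ext i
    simp only [Function.comp_apply, Equiv.swap_apply_def]
    grind
  rw [h7]
  split_ifs <;> simp_all

/-! ### The `𝔰𝔩₂` relation and injectivity of the raising operator -/

variable {β : Type*} [Fintype β]

/-- The raising operator of a system of directed edges `src e → tgt e` with coefficients `a e`. The
square roots make the lowering operator, obtained by exchanging `src` and `tgt`, its transpose. -/
noncomputable def hopSum (a : β → ℝ) (src tgt : β → ι) : Module.End ℝ ((ι → Bool) → ℝ) :=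
  ∑ e, √(a e) • hop (src e) (tgt e)

/-- The eigenvalue at the configuration `x` of the commutator of the raising and the lowering
operator. -/
def hopWeight (a : β → ℝ) (src tgt : β → ι) (x : ι → Bool) : ℝ :=
  ∑ e, a e * ((if x (tgt e) then 1 else 0) - (if x (src e) then 1 else 0))

theorem hopWeight_swap {σ : Type*} (a : β → ℝ) (src tgt : β → σ) (x : σ → Bool) :
    hopWeight a tgt src x = -hopWeight a src tgt x := by
  simp only [hopWeight, ← Finset.sum_neg_distrib]
  exact Finset.sum_congr rfl fun e _ => by ring

theorem hopSum_apply (a : β → ℝ) (src tgt : β → ι) (f : (ι → Bool) → ℝ) (x : ι → Bool) :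
    hopSum a src tgt f x = ∑ e, √(a e) * hop (src e) (tgt e) f x := by
  simp [hopSum]

/-- The `𝔰𝔩₂` relation `[E, F] = H`. Injectivity of `src` and `tgt` says that the edges form disjoint
directed paths or cycles, so only the terms with equal edges survive in the commutator. -/
theorem hopSum_commutator {a : β → ℝ} {src tgt : β → ι} (ha : ∀ e, 0 ≤ a e)
    (hsrc : Function.Injective src) (htgt : Function.Injective tgt)
    (f : (ι → Bool) → ℝ) (x : ι → Bool) :
    hopSum a src tgt (hopSum a tgt src f) x - hopSum a tgt src (hopSum a src tgt f) x =
      hopWeight a src tgt x * f x := by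
  classical
  have key : hopSum a src tgt * hopSum a tgt src - hopSum a tgt src * hopSum a src tgt =
      ∑ e, a e • (hop (src e) (tgt e) * hop (tgt e) (src e) -
        hop (tgt e) (src e) * hop (src e) (tgt e)) := by
    simp only [hopSum, Finset.sum_mul_sum, smul_mul_smul_comm]
    rw [Finset.sum_comm (f := fun i j => (√(a i) * √(a j)) • (hop (tgt i) (src i) * _)),
      ← Finset.sum_sub_distrib]
    refine Finset.sum_congr rfl fun e _ => ?_
    rw [← Finset.sum_sub_distrib, Finset.sum_eq_single e]
    · rw [Real.mul_self_sqrt (ha e), smul_sub]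
    · intro e' _ he
      rw [(hop_commute (hsrc.ne he.symm) (htgt.ne he.symm)).eq, mul_comm, sub_self]
    · simp
  have := congrFun (LinearMap.congr_fun key f) x
  rw [LinearMap.sub_apply, Pi.sub_apply, Module.End.mul_apply, Module.End.mul_apply] at this
  rw [this, hopWeight, Finset.sum_mul, LinearMap.sum_apply, Finset.sum_apply]
  refine Finset.sum_congr rfl fun e _ => ?_
  rw [LinearMap.smul_apply, Pi.smul_apply, LinearMap.sub_apply, Pi.sub_apply,
    Module.End.mul_apply, Module.End.mul_apply, hop_hop_reverse_apply, hop_hop_reverse_apply]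
  cases x (src e) <;> cases x (tgt e) <;> simp

theorem sum_mul_hopSum [Fintype ι] (a : β → ℝ) (src tgt : β → ι) (f g : (ι → Bool) → ℝ) :
    ∑ x, g x * hopSum a src tgt f x = ∑ x, hopSum a tgt src g x * f x := by
  simp only [hopSum_apply, Finset.mul_sum, Finset.sum_mul]
  refine Finset.sum_comm.trans (Eq.trans (Finset.sum_congr rfl fun e _ => ?_) Finset.sum_comm)
  simp only [mul_left_comm _ (√(a e)), mul_assoc, ← Finset.mul_sum, sum_mul_hop]

/-- The raising operator `E` is injective on functions supported where `H < 0`: if `E f = 0` then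
`‖F f‖² = ⟨f, E F f⟩ = ⟨f, H f⟩`, which is negative unless `f = 0`. -/
theorem eq_zero_of_hopSum_eq_zero [Fintype ι] {a : β → ℝ} {src tgt : β → ι} (ha : ∀ e, 0 ≤ a e)
    (hsrc : Function.Injective src) (htgt : Function.Injective tgt) {f : (ι → Bool) → ℝ}
    (hneg : ∀ x, f x ≠ 0 → hopWeight a src tgt x < 0) (hf : hopSum a src tgt f = 0) : f = 0 := by
  have h1 : ∑ x, hopSum a tgt src f x * hopSum a tgt src f x =
      ∑ x, hopWeight a src tgt x * (f x * f x) := by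
    rw [← sum_mul_hopSum]
    refine Finset.sum_congr rfl fun x _ => ?_
    have h := hopSum_commutator ha hsrc htgt f x
    rw [hf, map_zero, Pi.zero_apply, sub_zero] at h
    rw [h]; ring
  have h2 : ∀ x, hopWeight a src tgt x * (f x * f x) ≤ 0 := fun x => by
    by_cases hx : f x = 0
    · simp [hx]
    · exact mul_nonpos_of_nonpos_of_nonneg (hneg x hx).le (mul_self_nonneg _)
  have h3 : ∑ x, hopWeight a src tgt x * (f x * f x) = 0 :=
    le_antisymm (Finset.sum_nonpos fun x _ => h2 x)
      (h1 ▸ Finset.sum_nonneg fun x _ => mul_self_nonneg _)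
  rw [Finset.sum_eq_zero_iff_of_nonpos fun x _ => h2 x] at h3
  refine funext fun x => by_contra fun hx => ?_
  have := h3 x (Finset.mem_univ x)
  exact mul_ne_zero (hneg x hx).ne (mul_self_ne_zero.2 hx) this

/-- If every hop out of `A` ends in `B` and `H < 0` on `A`, the raising operator embeds the functions
on `A` into the functions on `B`. -/
theorem card_le_card_of_hop [Fintype ι] {a : β → ℝ} {src tgt : β → ι} (ha : ∀ e, 0 ≤ a e)
    (hsrc : Function.Injective src) (htgt : Function.Injective tgt) {A B : Finset (ι → Bool)}
    (hAB : ∀ e x, x (tgt e) = true → x (src e) = false →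
      x ∘ Equiv.swap (src e) (tgt e) ∈ A → x ∈ B)
    (hneg : ∀ x ∈ A, hopWeight a src tgt x < 0) : A.card ≤ B.card := by
  let R : (A → ℝ) →ₗ[ℝ] (B → ℝ) :=
    LinearMap.funLeft ℝ ℝ ((↑) : B → ι → Bool) ∘ₗ hopSum a src tgt ∘ₗ
      Function.ExtendByZero.linearMap ℝ ((↑) : A → ι → Bool)
  have hR : Function.Injective R := by
    refine (injective_iff_map_eq_zero R).2 fun g hg => ?_
    have hsupp : ∀ x, x ∉ A → Function.extend ((↑) : A → ι → Bool) g 0 x = 0 := fun x hx =>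
      Function.extend_apply' _ _ _ fun ⟨y, hy⟩ => hx (hy ▸ y.2)
    -- The raising operator kills the extension of `g` by zero: on `B` by hypothesis, and off `B`
    -- because no hop out of `A` ends there.
    have h0 : Function.extend ((↑) : A → ι → Bool) g 0 = 0 := by
      refine eq_zero_of_hopSum_eq_zero ha hsrc htgt
        (fun x hx => hneg x (not_imp_comm.1 (hsupp x) hx)) (funext fun x => ?_)
      by_cases hx : x ∈ B
      · exact congrFun hg ⟨x, hx⟩
      · rw [hopSum_apply, Pi.zero_apply]
        refine Finset.sum_eq_zero fun e _ => ?_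
        rw [hop_apply]
        split_ifs with h
        · rw [hsupp _ fun hA => hx (hAB e x h.1 h.2 hA), mul_zero]
        · rw [mul_zero]
    ext y
    rw [← Subtype.coe_injective.extend_apply g 0 y, h0]
    rfl
  simpa using LinearMap.finrank_le_finrank_of_injective hR

/-! ### Charge and energy of configurations -/

/-- The change of an additive statistic of a configuration when a particle hops from `s` to `t`; here
`x` is the configuration after the hop. -/
theorem sum_apply_comp_swap [Fintype ι] (φ : ι → Bool → ℤ) {x : ι → Bool} {s t : ι}
    (ht : x t = true) (hs : x s = false) :
    ∑ i, φ i (x i) = ∑ i, φ i (x (Equiv.swap s t i)) +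
      ((φ t true - φ t false) - (φ s true - φ s false)) := by
  have hne : s ≠ t := by rintro rfl; simp [hs] at ht
  rw [← sub_eq_iff_eq_add', ← Finset.sum_sub_distrib, Fintype.sum_eq_add s t hne]
  · simp only [Equiv.swap_apply_left, Equiv.swap_apply_right, hs, ht]
    ring
  · rintro i ⟨h1, h2⟩
    rw [Equiv.swap_apply_of_ne_of_ne h1 h2, sub_self]

/-- Summation by parts: the coefficients `(i + 1) (N - 1 - i)` of the irreducible `N`-dimensional
representation of `𝔰𝔩₂` have differences equal to its weights `2 i - (N - 1)`. -/
theorem sum_range_mul_sub (N : ℕ) (y : ℕ → ℝ) :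
    ∑ i ∈ Finset.range (N - 1), ((i : ℝ) + 1) * (N - 1 - i) * (y (i + 1) - y i) =
      ∑ i ∈ Finset.range N, (2 * (i : ℝ) - (N - 1)) * y i := by
  cases N with
  | zero => simp
  | succ M =>
    have h1 : ∑ i ∈ Finset.range M, ((i : ℝ) + 1) * (M - i) * y (i + 1) =
        ∑ i ∈ Finset.range (M + 1), (i : ℝ) * (M + 1 - i) * y i := by
      rw [Finset.sum_range_succ']
      simp
    have h2 : ∑ i ∈ Finset.range M, ((i : ℝ) + 1) * (M - i) * y i =
        ∑ i ∈ Finset.range (M + 1), ((i : ℝ) + 1) * (M - i) * y i := by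
      rw [Finset.sum_range_succ]
      simp
    simp only [Nat.add_sub_cancel, Nat.cast_succ, add_sub_cancel_right, mul_sub (_ * _),
      Finset.sum_sub_distrib, h1, h2]
    rw [← Finset.sum_sub_distrib]
    exact Finset.sum_congr rfl fun i _ => by ring

/-- The exponent of `z` contributed by the site `p`. The sites `p < n` stand for the factors
`1 + q ^ (n - 1 - p) z⁻¹`, with an empty site choosing the term with `z⁻¹`; the sites `p ≥ n` stand
for the factors `1 + q ^ (p - n + 1) z`, with an occupied site choosing the term with `z`. With this
convention occupying a site always raises the exponent of `z` by one. -/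
def siteCharge (n p : ℕ) (b : Bool) : ℤ :=
  if p < n then (if b then 0 else -1) else (if b then 1 else 0)

/-- The exponent of `q` contributed by the site `p`, for the same choice of terms as in
`siteCharge`. -/
def siteEnergy (n p : ℕ) (b : Bool) : ℕ :=
  if p < n then (if b then 0 else n - 1 - p) else (if b then p - n + 1 else 0)

theorem siteCharge_sub (n p : ℕ) : siteCharge n p true - siteCharge n p false = 1 := by
  by_cases h : p < n <;> simp [siteCharge, h]

theorem siteEnergy_sub (n p : ℕ) :
    (siteEnergy n p true : ℤ) - siteEnergy n p false = p - n + 1 := by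
  by_cases h : p < n <;> simp [siteEnergy, h] <;> omega

/-- The `𝔰𝔩₂` weight of an occupied site in terms of its energy and charge. The multiple of the charge
drops out for neutral configurations, and the last summand does not depend on the configuration. -/
theorem two_mul_siteEnergy (n m p : ℕ) (b : Bool) :
    (2 * (p : ℤ) - (n + m - 1)) * (if b then 1 else 0) =
      2 * siteEnergy n p b + (n - m - 1) * siteCharge n p b +
        (if p < n then 2 * (p : ℤ) + 1 - n - m else 0) := by
  unfold siteEnergy siteCharge
  cases b <;> split_ifs <;> simp_all <;> grind

/-- The exponent of `z` in the term of the expanded product that is given by `x`. -/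
def configCharge {k N : ℕ} (n : ℕ) (x : Fin k × Fin N → Bool) : ℤ :=
  ∑ i, siteCharge n i.2 (x i)

/-- The exponent of `q` in the term of the expanded product that is given by `x`. -/
def configEnergy {k N : ℕ} (n : ℕ) (x : Fin k × Fin N → Bool) : ℕ :=
  ∑ i, siteEnergy n i.2 (x i)

/-- The configurations on `k` chains of `n + m` sites whose terms are `z ^ 0 q ^ s`. -/
def neutralConfigs (k m n s : ℕ) : Finset (Fin k × Fin (n + m) → Bool) :=
  {x | configCharge n x = 0 ∧ configEnergy n x = s}

/-! ### The action of `𝔰𝔩₂` on the chains -/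

/-- The lower end of an edge; the edges join consecutive sites of a chain of `N` sites. -/
def edgeSource {k N : ℕ} (e : Fin k × Fin (N - 1)) : Fin k × Fin N :=
  (e.1, ⟨e.2, by omega⟩)

/-- The upper end of an edge. -/
def edgeTarget {k N : ℕ} (e : Fin k × Fin (N - 1)) : Fin k × Fin N :=
  (e.1, ⟨e.2 + 1, by omega⟩)

/-- The coefficient of an edge, as in the irreducible `N`-dimensional representation of `𝔰𝔩₂`. -/
def edgeCoeff {k N : ℕ} (e : Fin k × Fin (N - 1)) : ℝ :=
  ((e.2 : ℕ) + 1) * (N - 1 - (e.2 : ℕ))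

theorem edgeSource_injective {k N : ℕ} : Function.Injective (edgeSource (k := k) (N := N)) := by
  intro a b h
  simp only [edgeSource, Prod.mk.injEq, Fin.mk.injEq] at h
  exact Prod.ext h.1 (Fin.ext h.2)

theorem edgeTarget_injective {k N : ℕ} : Function.Injective (edgeTarget (k := k) (N := N)) := by
  intro a b h
  simp only [edgeTarget, Prod.mk.injEq, Fin.mk.injEq, Nat.add_right_cancel_iff] at h
  exact Prod.ext h.1 (Fin.ext h.2)

theorem edgeCoeff_nonneg {k N : ℕ} (e : Fin k × Fin (N - 1)) : 0 ≤ edgeCoeff e := by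
  have h : ((e.2 : ℕ) : ℝ) + 1 ≤ N := by exact_mod_cast (by omega : (e.2 : ℕ) + 1 ≤ N)
  unfold edgeCoeff
  have : (0 : ℝ) ≤ N - 1 - (e.2 : ℕ) := by linarith
  positivity

theorem hopWeight_edge {k N : ℕ} (x : Fin k × Fin N → Bool) :
    hopWeight edgeCoeff edgeSource edgeTarget x =
      ∑ i, (2 * ((i.2 : ℕ) : ℝ) - (N - 1)) * (if x i then 1 else 0) := by
  rw [hopWeight, Fintype.sum_prod_type, Fintype.sum_prod_type]
  refine Finset.sum_congr rfl fun c _ => ?_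
  have h := sum_range_mul_sub N fun p => if h : p < N then (if x (c, ⟨p, h⟩) then 1 else 0) else 0
  rw [Finset.sum_range, Finset.sum_range] at h
  simp only [Fin.is_lt, dite_true, Fin.eta] at h
  rw [← h]
  refine Finset.sum_congr rfl fun i _ => ?_
  rw [dif_pos (by omega), dif_pos (by omega)]
  rfl

theorem sum_fin_ite_lt (n m : ℕ) :
    ∑ p : Fin (n + m), (if (p : ℕ) < n then 2 * ((p : ℕ) : ℤ) + 1 - n - m else 0) = -(n * m) := by
  have h : ∀ c : ℤ, ∑ p ∈ Finset.range n, (2 * (p : ℤ) + 1 - n - c) = -(n * c) := by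
    intro c
    have h1 : ∑ p ∈ Finset.range n, (2 * (p : ℤ) + 1) = n * n := by
      induction n with
      | zero => simp
      | succ n ih => rw [Finset.sum_range_succ, ih]; push_cast; ring
    simp only [Finset.sum_sub_distrib, h1, Finset.sum_const, Finset.card_range, nsmul_eq_mul]
    ring
  rw [Fin.sum_univ_add, ← h m, Finset.sum_range]
  simp

/-- The `𝔰𝔩₂` weight of a neutral configuration is twice the signed distance of its energy from the
centre of symmetry `k * m * n / 2`. -/
theorem hopWeight_neutralConfigs {k m n s : ℕ} {x : Fin k × Fin (n + m) → Bool}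
    (hx : x ∈ neutralConfigs k m n s) :
    hopWeight edgeCoeff edgeSource edgeTarget x = 2 * s - k * m * n := by
  simp only [neutralConfigs, Finset.mem_filter, Finset.mem_univ, true_and] at hx
  have h : ∑ i : Fin k × Fin (n + m),
      (2 * ((i.2 : ℕ) : ℤ) - (n + m - 1)) * (if x i then 1 else 0) = 2 * s - k * m * n := by
    simp only [two_mul_siteEnergy, Finset.sum_add_distrib, ← Finset.mul_sum]
    rw [← configCharge, hx.1, ← Nat.cast_sum, ← configEnergy, hx.2, Fintype.sum_prod_type]
    simp only [sum_fin_ite_lt, Finset.sum_const, Finset.card_univ, Fintype.card_fin, nsmul_eq_mul]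
    ring
  rw [hopWeight_edge]
  exact_mod_cast congrArg (Int.cast : ℤ → ℝ) h

/-- A hop to the next site preserves the charge and raises the energy by one. Here `x` is the
configuration after the hop. -/
theorem mem_neutralConfigs_of_hop {k m n s : ℕ} {x : Fin k × Fin (n + m) → Bool}
    (e : Fin k × Fin (n + m - 1)) (h1 : x (edgeTarget e) = true) (h0 : x (edgeSource e) = false) :
    x ∘ Equiv.swap (edgeSource e) (edgeTarget e) ∈ neutralConfigs k m n s ↔
      x ∈ neutralConfigs k m n (s + 1) := by
  have hc := sum_apply_comp_swap (fun i => siteCharge n i.2) h1 h0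
  have he := sum_apply_comp_swap (fun i b => (siteEnergy n i.2 b : ℤ)) h1 h0
  simp only [siteCharge_sub, siteEnergy_sub, sub_self, add_zero] at hc he
  simp only [neutralConfigs, Finset.mem_filter, Finset.mem_univ, true_and]
  unfold configCharge configEnergy
  simp only [Function.comp_apply]
  rw [hc, ← Nat.cast_inj (R := ℤ), ← Nat.cast_inj (R := ℤ) (m := _) (n := s + 1)]
  push_cast
  rw [he]
  simp only [edgeTarget, edgeSource]
  push_cast
  refine and_congr_right fun _ => ?_
  constructor <;> intro h <;> linarith

theorem card_neutralConfigs_le_succ {k m n s : ℕ} (h : 2 * s < k * m * n) :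
    (neutralConfigs k m n s).card ≤ (neutralConfigs k m n (s + 1)).card := by
  refine card_le_card_of_hop edgeCoeff_nonneg edgeSource_injective edgeTarget_injective
    (fun e x h1 h0 => (mem_neutralConfigs_of_hop e h1 h0).1) fun x hx => ?_
  rw [hopWeight_neutralConfigs hx, sub_neg]
  exact_mod_cast h

theorem card_neutralConfigs_succ_le {k m n s : ℕ} (h : k * m * n < 2 * (s + 1)) :
    (neutralConfigs k m n (s + 1)).card ≤ (neutralConfigs k m n s).card := by
  refine card_le_card_of_hop edgeCoeff_nonneg edgeTarget_injective edgeSource_injective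
    (fun e x h1 h0 hx => ?_) fun x hx => ?_
  · have := mem_neutralConfigs_of_hop (m := m) (n := n) (s := s)
      (x := x ∘ Equiv.swap (edgeSource e) (edgeTarget e)) e (by simpa using h1) (by simpa using h0)
    rw [comp_swap_comp_swap, Equiv.swap_comm] at this
    exact this.2 hx
  · rw [hopWeight_swap, hopWeight_neutralConfigs hx, neg_sub, sub_neg]
    exact_mod_cast h

/-! ### Expansion of the constant term -/

open LaurentPolynomial in
/-- The product of the site contributions along one chain, both states of each site being summed. The
sites below `n` give the factors with `z⁻¹` in reverse order. -/
theorem prod_range_siteSum (m n : ℕ) :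
    ∏ p ∈ Finset.range (n + m), ∑ b : Bool,
      (C ((Polynomial.X : Polynomial ℤ) ^ siteEnergy n p b) * T (siteCharge n p b)) =
    qShiftedFactorial (-(C (Polynomial.X : Polynomial ℤ) * T 1)) (C (Polynomial.X : Polynomial ℤ)) m *
      qShiftedFactorial (-T (-1)) (C (Polynomial.X : Polynomial ℤ)) n := by
  rw [Finset.prod_range_add, mul_comm]
  congr 1
  · refine Finset.prod_congr rfl fun j _ => ?_
    simp [siteEnergy, siteCharge, pow_succ]
    ring
  · rw [qShiftedFactorial, ← Finset.prod_range_reflect]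
    refine Finset.prod_congr rfl fun j hj => ?_
    have h := Finset.mem_range.1 hj
    have h1 : n - 1 - j < n := by omega
    have h2 : n - 1 - (n - 1 - j) = j := by omega
    simp [siteEnergy, siteCharge, h1, h2]
    ring

/-- Expanding the product: the coefficients of the generalized Gauss polynomial count neutral
configurations by energy. -/
theorem coeff_andrewsGaussC (k m n s : ℕ) :
    (andrewsGaussC k m n).coeff s = (neutralConfigs k m n s).card := by
  have h : ∀ x : Fin k × Fin (n + m) → Bool,
      ∏ i, (LaurentPolynomial.C ((Polynomial.X : Polynomial ℤ) ^ siteEnergy n i.2 (x i)) *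
        LaurentPolynomial.T (siteCharge n i.2 (x i))) =
      LaurentPolynomial.C ((Polynomial.X : Polynomial ℤ) ^ configEnergy n x) *
        LaurentPolynomial.T (configCharge n x) := by
    intro x
    have hT : ∀ S : Finset (Fin k × Fin (n + m)),
        ∏ i ∈ S, (LaurentPolynomial.T (siteCharge n i.2 (x i)) : LaurentPolynomial (Polynomial ℤ)) =
          LaurentPolynomial.T (∑ i ∈ S, siteCharge n i.2 (x i)) := by
      intro S
      induction S using Finset.cons_induction with
      | empty => simp
      | cons i S hi ih => rw [Finset.prod_cons, Finset.sum_cons, ih, LaurentPolynomial.T_add]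
    rw [Finset.prod_mul_distrib, ← map_prod, Finset.prod_pow_eq_pow_sum, hT]
    rfl
  have hprod : ∏ _c : Fin k, ∏ p : Fin (n + m), ∑ b : Bool,
      (LaurentPolynomial.C ((Polynomial.X : Polynomial ℤ) ^ siteEnergy n p b) *
        LaurentPolynomial.T (siteCharge n p b)) =
      ∑ x : Fin k × Fin (n + m) → Bool,
        LaurentPolynomial.C ((Polynomial.X : Polynomial ℤ) ^ configEnergy n x) *
          LaurentPolynomial.T (configCharge n x) := by
    rw [← Fintype.prod_prod_type', Fintype.prod_sum]
    exact Finset.sum_congr rfl fun x _ => h x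
  rw [andrewsGaussC, constantTermZ, ← mul_pow, ← prod_range_siteSum, Finset.prod_range,
    ← Fin.prod_const, hprod, AddMonoidAlgebra.coeff_sum, Finsupp.finsetSum_apply,
    Polynomial.finsetSum_coeff, neutralConfigs, Finset.card_filter, Nat.cast_sum]
  refine Finset.sum_congr rfl fun x _ => ?_
  rw [← LaurentPolynomial.single_eq_C_mul_T, AddMonoidAlgebra.coeff_single, Finsupp.single_apply]
  split_ifs <;> simp_all [Polynomial.coeff_X_pow, eq_comm]

theorem mainTheorem2 (m n k : ℕ) (hk : 1 ≤ k) :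
    IsUnimodalPolynomial (andrewsGaussC k m n) := by
  -- The minimum guards the requirement that the peak lie within the degree; that the degree is at
  -- least `k * m * n / 2` is not needed, since the second range is trivial otherwise.
  refine ⟨min (k * m * n / 2) (andrewsGaussC k m n).natDegree, min_le_right _ _, ?_, ?_⟩
  · refine monotoneOn_of_le_add_one Set.ordConnected_Icc fun s _ _ hs => ?_
    rw [coeff_andrewsGaussC, coeff_andrewsGaussC]
    have := hs.2
    exact_mod_cast card_neutralConfigs_le_succ (by omega)
  · refine antitoneOn_of_add_one_le Set.ordConnected_Icc fun s _ hs hs' => ?_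
    rw [coeff_andrewsGaussC, coeff_andrewsGaussC]
    have := hs.1
    have := hs'.2
    exact_mod_cast card_neutralConfigs_succ_le (by omega)
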